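/- All graphs are finite, undirected and simple. For a graph $G$ on $n$ vertices let $0=\mu_1(G)\le\mu_2(G)\le\cdots\le\mu_n(G)$ be the eigenvalues, with multiplicities, of its Laplacian matrix $L(G)=D(G)-A(G)$, and let $t(G)$ be the number of spanning trees of $G$. The subdivision graph $\mathcal S(G)$ is obtained from $G$ by inserting a new vertex into every edge of $G$; $I(G)$ denotes the set of inserted vertices. The subdivision-edge neighbourhood corona $G_1\boxminus G_2$ is the graph obtained from $\mathcal S(G_1)$ and $|I(G_1)|$ copies of $G_2$, all vertex-disjoint, by joining the neighbours (in $\mathcal S(G_1)$) of the $i$th vertex of $I(G_1)$ to every vertex of the $i$th copy of $G_2$. **Corollary 3.7.** Let $G_1$ be an $r_1$-regular graph on $n_1\ge 1$ vertices and with $m_1$ edges, and let $G_2$ be an arbitrary graph on $n_2$ vertices. Then $$t(G_1\boxminus G_2)=\frac{2^{m_1-n_1}\cdot(2+r_1+r_1n_2)\cdot\prod_{i=1}^{n_2}\bigl(2+\mu_i(G_2)\bigr)^{m_1}\cdot\prod_{i=2}^{n_1}(1+n_2)\,\mu_i(G_1)}{n_1+m_1+m_1n_2},$$ where each factor of the last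 product is $(1+n_2)\mu_i(G_1)$. -/

import Mathlib

namespace SimpleGraph

/-- The subdivision graph `S(G)`: a new vertex is inserted into every edge of `G`. Its vertices are
the vertices `Sum.inl v` of `G` together with one inserted vertex `Sum.inr e` per edge `e`, and
the inserted vertex `e` is joined exactly to the two ends of the edge `e`. -/
def subdivisionGraph {V : Type*} (G : SimpleGraph V) : SimpleGraph (V ⊕ G.edgeSet) where
  Adj x y :=
    match x, y with
    | Sum.inl v, Sum.inr e => v ∈ (e : Sym2 V)
    | Sum.inr e, Sum.inl v => v ∈ (e : Sym2 V)
    | Sum.inl _, Sum.inl _ => False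
    | Sum.inr _, Sum.inr _ => False
  symm := ⟨by
    rintro (v | e) (w | f) h
    · exact h
    · exact h
    · exact h
    · exact h⟩
  loopless := ⟨by
    rintro (v | e) h
    · exact h
    · exact h⟩

/-- The subdivision-edge neighbourhood corona `G₁ ⊟ G₂`: the disjoint union of `S(G₁)` and of one
copy of `G₂` for each inserted vertex `e` of `S(G₁)` (the vertices of this copy are the
`Sum.inr (e, u)`), where moreover every neighbour of the inserted vertex `e` in `S(G₁)` is joined
to every vertex of the copy of `G₂` that belongs to `e`. -/
def subdivisionEdgeNbhdCorona {V₁ V₂ : Type*} (G₁ : SimpleGraph V₁) (G₂ : SimpleGraph V₂) :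
    SimpleGraph ((V₁ ⊕ G₁.edgeSet) ⊕ (G₁.edgeSet × V₂)) where
  Adj x y :=
    match x, y with
    | Sum.inl a, Sum.inl b => G₁.subdivisionGraph.Adj a b
    | Sum.inl a, Sum.inr p => G₁.subdivisionGraph.Adj (Sum.inr p.1) a
    | Sum.inr p, Sum.inl a => G₁.subdivisionGraph.Adj (Sum.inr p.1) a
    | Sum.inr p, Sum.inr q => p.1 = q.1 ∧ G₂.Adj p.2 q.2
  symm := ⟨by
    rintro (a | p) (b | q) h
    · exact SimpleGraph.Adj.symm h
    · exact h
    · exact h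
    · exact ⟨h.1.symm, h.2.symm⟩⟩
  loopless := ⟨by
    rintro (a | p) h
    · exact G₁.subdivisionGraph.irrefl h
    · exact G₂.irrefl h.2⟩

/-- The number `t(G)` of spanning trees of `G`: the trees on the whole vertex set of `G` all of
whose edges are edges of `G`. (The set is finite when `V` is.) -/
noncomputable def numSpanningTrees {V : Type*} (G : SimpleGraph V) : ℕ :=
  Set.ncard {T : SimpleGraph V | T ≤ G ∧ T.IsTree}

/-- The eigenvalues of the Laplacian matrix `L(G) = D(G) - A(G)`, with multiplicities and in
increasing order; indices start at `0`, so `G.lapEigenvalue i` is `μ_{i+1}(G)`. -/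
noncomputable def lapEigenvalue {V : Type*} [Fintype V] [DecidableEq V] (G : SimpleGraph V)
    [DecidableRel G.Adj] (i : Fin (Fintype.card V)) : ℝ :=
  (G.isHermitian_lapMatrix (R := ℝ)).eigenvalues₀ i.rev

end SimpleGraph

/-!
The number of spanning trees of a graph `H` is the determinant of its Laplacian matrix with one row
replaced by a unit vector (`SimpleGraph.det_updateRow_lapMatrix`). Expanding that determinant
multilinearly along the rows gives one term for every choice of a neighbour `p v` of each
non-root vertex `v`. The term is `1` if all orbits of `p` end in the root and `0` otherwise, and the
maps of the first kind correspond to the spanning trees, `p` being the first step towards the root.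
Since `L(H)` is symmetric with zero row sums, the same number governs all rank-one perturbations:
`det (L(H) + u vᵀ) = (∑ u) (∑ v) t(H)` (`SimpleGraph.det_lapMatrix_add_vecMulVec`).

For `H = G₁ ⊟ G₂`, take for `u = v` the indicator vector of `V₁`. On the remaining vertices, `L(H)`
is the block matrix of `2` for each inserted vertex and `2 + L(G₂)` for each copy of `G₂`, with
determinant `2 ^ m₁ ∏ (2 + μᵢ(G₂)) ^ m₁`. A vector that is constant on each inserted vertex together
with its copy is an eigenvector of this block for the eigenvalue `2`, so eliminating the block leaves
`D (1 + n₂) - (1 + n₂) / 2 (D + A) = (1 + n₂) / 2 L(G₁)` on `V₁`, plus the all-ones matrix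
(`SimpleGraph.det_corona_fromBlocks`). Finally `det (c L(G₁) + J) = n₁ ∏_{i ≥ 2} c μᵢ(G₁)`, because
the all-ones vector is an eigenvector of `L(G₁)` for `μ₁ = 0`. This evaluates `t(G₁ ⊟ G₂)` for
arbitrary `G₁`; regularity enters only through `n₁ r₁ = 2 m₁`, which gives
`(2 + r₁ + r₁ n₂) / (n₁ + m₁ + m₁ n₂) = 2 / n₁`.
-/

/-! ### The matrix-tree theorem -/

namespace SimpleGraph

open Finset Matrix

variable {V : Type*}

/-- The graph of a parent map `p`: every vertex `v` with `p v ≠ v` is joined to `p v`. -/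
def parentGraph (p : V → V) : SimpleGraph V :=
  SimpleGraph.fromRel fun v w => p v = w

/-- A self-map `p` of the vertices is a parent map of `G` towards the root `r` if it fixes `r`,
sends every other vertex to one of its neighbours, and all its orbits end in `r`. -/
structure IsParentMap (G : SimpleGraph V) (r : V) (p : V → V) : Prop where
  root : p r = r
  adj : ∀ v, v ≠ r → G.Adj v (p v)
  reach : ∀ v, ∃ k, p^[k] v = r

lemma parentGraph_le {G : SimpleGraph V} {r : V} {p : V → V} (hp : G.IsParentMap r p) :
    parentGraph p ≤ G := by
  have key : ∀ v, v ≠ p v → G.Adj v (p v) := fun v hv =>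
    hp.adj v fun h => hv (by rw [h, hp.root])
  intro v w h
  rw [parentGraph, fromRel_adj] at h
  obtain ⟨hne, rfl | rfl⟩ := h
  · exact key v hne
  · exact (key w hne.symm).symm

lemma connected_parentGraph {p : V → V} {r : V} (h : ∀ v, ∃ k, p^[k] v = r) :
    (parentGraph p).Connected := by
  have key : ∀ k v, (parentGraph p).Reachable v (p^[k] v) := by
    intro k
    induction k with
    | zero => exact fun v => Reachable.refl v
    | succ k ih =>
      intro v
      rw [Function.iterate_succ_apply]
      refine Reachable.trans ?_ (ih (p v))
      by_cases hv : v = p v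
      · rw [← hv]
      · exact Adj.reachable (by rw [parentGraph, fromRel_adj]; exact ⟨hv, Or.inl rfl⟩)
  have hr : ∀ v, (parentGraph p).Reachable v r := fun v => by
    obtain ⟨k, hk⟩ := h v
    exact hk ▸ key k v
  exact { preconnected := fun v w => (hr v).trans (hr w).symm, nonempty := ⟨r⟩ }

/-- The graph of a parent map is connected and has at most one edge per vertex other than the
root, so it is a tree. -/
lemma isTree_parentGraph [Finite V] {p : V → V} {r : V} (hr : p r = r)
    (h : ∀ v, ∃ k, p^[k] v = r) : (parentGraph p).IsTree := by
  classical
  have := Fintype.ofFinite V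
  have hc := connected_parentGraph h
  refine isTree_iff_connected_and_card.2 ⟨hc, le_antisymm ?_ hc.card_vert_le_card_edgeSet_add_one⟩
  have hsub : (parentGraph p).edgeSet ⊆ ((univ.erase r).image fun v => s(v, p v) : Finset _) := by
    intro e
    induction e with
    | h v w =>
      rw [mem_edgeSet, parentGraph, fromRel_adj]
      rintro ⟨hne, rfl | rfl⟩
      · refine mem_coe.2 (mem_image.2 ⟨v, ?_, rfl⟩)
        exact mem_erase.2 ⟨fun hv => hne (by rw [hv, hr]), mem_univ _⟩
      · refine mem_coe.2 (mem_image.2 ⟨w, ?_, Sym2.eq_swap⟩)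
        exact mem_erase.2 ⟨fun hv => hne (by rw [hv, hr]), mem_univ _⟩
  have h1 : Nat.card (parentGraph p).edgeSet ≤ (univ.erase r).card := by
    refine (Nat.card_mono (Finset.finite_toSet _) hsub).trans ?_
    rw [Nat.card_coe_set_eq, Set.ncard_coe_finset]
    exact card_image_le
  rw [card_erase_of_mem (mem_univ r), card_univ] at h1
  have : 0 < Fintype.card V := Fintype.card_pos_iff.2 ⟨r⟩
  rw [Nat.card_eq_fintype_card (α := V)]
  omega

/-- If two parent maps with the same graph differed at `v`, then they would also differ at the
parent of `v`, and so on along the whole orbit of `v`, which ends in the common root. -/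
lemma parentGraph_injOn (G : SimpleGraph V) (r : V) :
    Set.InjOn parentGraph {p | G.IsParentMap r p} := by
  intro p hp q hq hpq
  have hp : G.IsParentMap r p := hp
  have hq : G.IsParentMap r q := hq
  have key : ∀ k v, p v ≠ q v → q^[k] v ≠ r := by
    intro k
    induction k with
    | zero =>
      rintro v hv rfl
      exact hv (hp.root.trans hq.root.symm)
    | succ k ih =>
      intro v hv
      rw [Function.iterate_succ_apply]
      have hvr : v ≠ r := by
        rintro rfl
        exact hv (hp.root.trans hq.root.symm)
      have hadj : (parentGraph p).Adj v (q v) := by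
        rw [hpq, parentGraph, fromRel_adj]
        exact ⟨(hq.adj v hvr).ne, Or.inl rfl⟩
      rw [parentGraph, fromRel_adj] at hadj
      have hpv : p (q v) = v := hadj.2.resolve_left hv
      refine ih (q v) fun h => ?_
      have hqv : q (q v) = v := h.symm.trans hpv
      -- the orbit of `v` under `q` would be a 2-cycle avoiding the root
      have hcyc : ∀ j, q^[j] v ≠ r ∧ q^[j] (q v) ≠ r := by
        intro j
        induction j with
        | zero => exact ⟨hvr, fun h' => hvr (hpv.symm.trans ((congrArg p h').trans hp.root))⟩
        | succ j ihj => exact ⟨ihj.2, by rw [Function.iterate_succ_apply, hqv]; exact ihj.1⟩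
      obtain ⟨j, hj⟩ := hq.reach v
      exact (hcyc j).1 hj
  funext v
  by_contra hv
  obtain ⟨k, hk⟩ := hq.reach v
  exact key k v hv hk

lemma Connected.exists_isParentMap {T : SimpleGraph V} (hT : T.Connected) (r : V) :
    ∃ p, T.IsParentMap r p := by
  classical
  have step : ∀ v, ∃ w, (v = r → w = r) ∧ (v ≠ r → T.Adj v w ∧ T.dist w r < T.dist v r) := by
    intro v
    by_cases hv : v = r
    · exact ⟨r, fun _ => rfl, fun h => absurd hv h⟩
    · obtain ⟨P, hP⟩ := hT.exists_walk_length_eq_dist v r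
      cases P with
      | nil => exact absurd rfl hv
      | cons h P =>
        refine ⟨_, fun h => absurd h hv, fun _ => ⟨h, ?_⟩⟩
        rw [← hP, Walk.length_cons]
        exact Nat.lt_succ_of_le (dist_le P)
  choose p hp1 hp2 using step
  refine ⟨p, hp1 r rfl, fun v hv => (hp2 v hv).1, ?_⟩
  have : ∀ n v, T.dist v r < n → ∃ k, p^[k] v = r := by
    intro n
    induction n with
    | zero => exact fun v h => absurd h (Nat.not_lt_zero _)
    | succ n ih =>
      intro v h
      by_cases hv : v = r
      · exact ⟨0, hv⟩
      · obtain ⟨k, hk⟩ := ih (p v) (by have := (hp2 v hv).2; omega)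
        exact ⟨k + 1, hk⟩
  exact fun v => this _ v (Nat.lt_succ_self _)

/-- A spanning tree is the graph of the map that moves every vertex one step towards the root. -/
lemma image_parentGraph [Finite V] (G : SimpleGraph V) (r : V) :
    parentGraph '' {p | G.IsParentMap r p} = {T : SimpleGraph V | T ≤ G ∧ T.IsTree} := by
  ext T
  constructor
  · rintro ⟨p, hp, rfl⟩
    have hp : G.IsParentMap r p := hp
    exact ⟨parentGraph_le hp, isTree_parentGraph hp.root hp.reach⟩
  · rintro ⟨hTG, hT⟩
    obtain ⟨p, hp⟩ := hT.connected.exists_isParentMap r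
    refine ⟨p, ⟨hp.root, fun v hv => hTG (hp.adj v hv), hp.reach⟩, ?_⟩
    exact le_antisymm (parentGraph_le hp)
      ((isTree_iff_minimal_connected.1 hT).2 (connected_parentGraph hp.reach) (parentGraph_le hp))

lemma numSpanningTrees_eq_ncard_isParentMap [Finite V] (G : SimpleGraph V) (r : V) :
    G.numSpanningTrees = Set.ncard {p | G.IsParentMap r p} := by
  rw [numSpanningTrees, ← image_parentGraph G r,
    (parentGraph_injOn G r).ncard_image]

variable [Fintype V] [DecidableEq V]

/-- The matrix whose row `r` is the unit vector `e_r` and whose row `v ≠ r` is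
`e_v - e_{p v}`. -/
def parentMatrix (r : V) (p : V → V) : Matrix V V ℝ :=
  Matrix.of fun v => if v = r then Pi.single r 1 else Pi.single v 1 - Pi.single (p v) 1

/-- Ordered by the distance to the root along `p`, the matrix is triangular with unit diagonal. -/
lemma det_parentMatrix_of_reach {r : V} {p : V → V} (h : ∀ v, ∃ k, p^[k] v = r) :
    (parentMatrix r p).det = 1 := by
  let b : V → ℕᵒᵈ := fun v => OrderDual.toDual (Nat.find (h v))
  have hb : ∀ v, v ≠ r → Nat.find (h (p v)) < Nat.find (h v) := by
    intro v hv
    have hpos : Nat.find (h v) ≠ 0 := fun h0 => hv (by simpa [h0] using Nat.find_spec (h v))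
    obtain ⟨k, hk⟩ := Nat.exists_eq_succ_of_ne_zero hpos
    have hspec := Nat.find_spec (h v)
    rw [hk, Function.iterate_succ_apply] at hspec
    have := Nat.find_min' (h (p v)) hspec
    omega
  have htri : (parentMatrix r p).BlockTriangular b := by
    intro v w hvw
    have hvw' : Nat.find (h v) < Nat.find (h w) := hvw
    have hne : w ≠ v := by rintro rfl; exact lt_irrefl _ hvw'
    by_cases hv : v = r
    · subst hv
      simp [parentMatrix, hne]
    · have hne' : w ≠ p v := by
        rintro rfl
        exact lt_asymm hvw' (hb v hv)
      simp [parentMatrix, hv, hne, hne']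
  rw [htri.det]
  refine prod_eq_one fun a _ => ?_
  have : (parentMatrix r p).toSquareBlock b a = 1 := by
    ext ⟨v, hv⟩ ⟨w, hw⟩
    have hvw : Nat.find (h v) = Nat.find (h w) :=
      OrderDual.toDual.injective (hv.trans hw.symm)
    by_cases hvr : v = r
    · subst hvr
      simp [parentMatrix, toSquareBlock_def, Matrix.one_apply, Pi.single_apply, eq_comm]
    · have hne' : w ≠ p v := by
        rintro rfl
        exact (hb v hvr).ne hvw.symm
      simp [parentMatrix, toSquareBlock_def, Matrix.one_apply, Pi.single_apply, hvr, hne',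
        eq_comm (a := v) (b := w)]
  rw [this, det_one]

/-- The indicator vector of the vertices that never reach the root lies in the kernel. -/
lemma det_parentMatrix_of_not_reach {r : V} {p : V → V} (h : ¬ ∀ v, ∃ k, p^[k] v = r) :
    (parentMatrix r p).det = 0 := by
  classical
  push Not at h
  obtain ⟨v₀, hv₀⟩ := h
  refine exists_mulVec_eq_zero_iff.1
    ⟨fun v => if ∃ k, p^[k] v = r then 0 else 1, fun h0 => ?_, ?_⟩
  · have := congrFun h0 v₀
    simp [hv₀] at this
  · ext v
    rw [mulVec]
    by_cases hv : v = r
    · subst hv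
      have : ∃ k, p^[k] v = v := ⟨0, rfl⟩
      simp [parentMatrix, this]
    · have : (∃ k, p^[k] v = r) ↔ ∃ k, p^[k] (p v) = r := by
        constructor
        · rintro ⟨_ | k, hk⟩
          · exact absurd hk hv
          · exact ⟨k, hk⟩
        · rintro ⟨k, hk⟩
          exact ⟨k + 1, hk⟩
      have hM : parentMatrix r p v = Pi.single v 1 - Pi.single (p v) 1 := if_neg hv
      change parentMatrix r p v ⬝ᵥ _ = 0
      rw [hM, sub_dotProduct, single_one_dotProduct, single_one_dotProduct]
      simp only [this, sub_self]

variable (G : SimpleGraph V) [DecidableRel G.Adj]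

lemma lapMatrix_row (v : V) :
    G.lapMatrix ℝ v = ∑ w, (if G.Adj v w then (1 : ℝ) else 0) •
      ((Pi.single v 1 : V → ℝ) - Pi.single w 1) := by
  ext u
  simp only [Finset.sum_apply, Pi.smul_apply, Pi.sub_apply, smul_eq_mul, mul_sub,
    Finset.sum_sub_distrib, ← Finset.sum_mul, ← degree_eq_sum_if_adj]
  simp [lapMatrix, degMatrix, Matrix.diagonal_apply, Pi.single_apply, eq_comm]

/-- The **matrix-tree theorem**: replacing row `r` of the Laplacian matrix by the unit vector `e_r`
gives a matrix whose determinant is the number of spanning trees. -/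
theorem det_updateRow_lapMatrix (r : V) :
    ((G.lapMatrix ℝ).updateRow r (Pi.single r 1)).det = G.numSpanningTrees := by
  classical
  have hrow : (G.lapMatrix ℝ).updateRow r (Pi.single r 1) =
      fun v => ∑ w, (if v = r then (if w = r then (1 : ℝ) else 0) else
        if G.Adj v w then 1 else 0) •
        (if v = r then (Pi.single r 1 : V → ℝ) else Pi.single v 1 - Pi.single w 1) := by
    funext v
    by_cases hv : v = r
    · subst hv
      simp
    · rw [updateRow_ne hv, lapMatrix_row]
      simp only [hv, if_false]
  have hcoef : ∀ p : V → V, (∏ v, (if v = r then (if p v = r then (1 : ℝ) else 0) else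
      if G.Adj v (p v) then 1 else 0)) * (parentMatrix r p).det =
      if G.IsParentMap r p then 1 else 0 := by
    intro p
    by_cases hp : G.IsParentMap r p
    · rw [if_pos hp, det_parentMatrix_of_reach hp.reach, mul_one]
      refine prod_eq_one fun v _ => ?_
      by_cases hv : v = r
      · simp [hv, hp.root]
      · simp [hv, hp.adj v hv]
    · rw [if_neg hp]
      by_cases hreach : ∀ v, ∃ k, p^[k] v = r
      · refine mul_eq_zero_of_left ?_ _
        by_contra hne
        rw [← ne_eq, prod_ne_zero_iff] at hne
        refine hp ⟨?_, fun v hv => ?_, hreach⟩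
        · simpa using hne r (mem_univ r)
        · simpa [hv] using hne v (mem_univ v)
      · rw [det_parentMatrix_of_not_reach hreach, mul_zero]
  calc ((G.lapMatrix ℝ).updateRow r (Pi.single r 1)).det
      = detRowAlternating.toMultilinearMap (fun v => ∑ w, (if v = r then
          (if w = r then (1 : ℝ) else 0) else if G.Adj v w then 1 else 0) •
          (if v = r then (Pi.single r 1 : V → ℝ) else Pi.single v 1 - Pi.single w 1)) :=
        congrArg detRowAlternating hrow
    _ = ∑ p : V → V, (∏ v, (if v = r then (if p v = r then (1 : ℝ) else 0) else
          if G.Adj v (p v) then 1 else 0)) * (parentMatrix r p).det := by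
        rw [MultilinearMap.map_sum]
        refine Finset.sum_congr rfl fun p _ => ?_
        rw [MultilinearMap.map_smul_univ]
        rfl
    _ = G.numSpanningTrees := by
        rw [Finset.sum_congr rfl fun p _ => hcoef p, Finset.sum_boole,
          numSpanningTrees_eq_ncard_isParentMap G r, Set.ncard_eq_toFinset_card',
          Set.toFinset_ofPred]

end SimpleGraph

/-! ### Rank-one perturbations and Laplacian eigenvalues -/

namespace Matrix

open Finset

variable {V : Type*} [Fintype V] [DecidableEq V]

lemma det_one_add_vecMulVec (u v : V → ℝ) : (1 + vecMulVec u v).det = 1 + v ⬝ᵥ u := by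
  rw [vecMulVec_eq Unit, det_one_add_replicateCol_mul_replicateRow]

/-- If the rows of `L` sum to zero, then the row vector `v` enters `det (L + u vᵀ)` only through
the sum of its entries: indeed `L + u vᵀ` is the product of `L + u 1ᵀ` and `1 + 1 wᵀ`, where
`v = 1 + card V • w`. -/
lemma card_mul_det_add_vecMulVec [Nonempty V] {L : Matrix V V ℝ} (hL : L *ᵥ 1 = 0)
    (u v : V → ℝ) :
    (Fintype.card V : ℝ) * (L + vecMulVec u v).det =
      (∑ i, v i) * (L + vecMulVec u 1).det := by
  have hn : (Fintype.card V : ℝ) ≠ 0 := Nat.cast_ne_zero.2 Fintype.card_ne_zero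
  set w : V → ℝ := (Fintype.card V : ℝ)⁻¹ • (v - 1) with hw
  have hprod : (L + vecMulVec u 1) * (1 + vecMulVec 1 w) = L + vecMulVec u v := by
    rw [mul_add, mul_one, mul_vecMulVec, add_mulVec, hL, zero_add, vecMulVec_mulVec, add_assoc]
    congr 1
    ext i j
    simp [vecMulVec_apply, hw, dotProduct]
    field_simp
    ring
  have hdet : (1 + vecMulVec (1 : V → ℝ) w).det = (∑ i, v i) / Fintype.card V := by
    rw [det_one_add_vecMulVec]
    simp [hw, dotProduct, ← Finset.mul_sum]
    field_simp
    ring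
  rw [← hprod, det_mul, hdet]
  field_simp

lemma card_sq_mul_det_add_vecMulVec [Nonempty V] {L : Matrix V V ℝ} (hLs : L.IsSymm)
    (hL : L *ᵥ 1 = 0) (u v : V → ℝ) :
    (Fintype.card V : ℝ) ^ 2 * (L + vecMulVec u v).det =
      (∑ i, u i) * (∑ i, v i) * (L + vecMulVec 1 1).det := by
  have h1 := card_mul_det_add_vecMulVec hL u v
  have h2 := card_mul_det_add_vecMulVec hL 1 u
  have h3 : (L + vecMulVec 1 u).det = (L + vecMulVec u 1).det := by
    rw [← det_transpose, transpose_add, transpose_vecMulVec, hLs.eq]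
  rw [h3] at h2
  linear_combination (Fintype.card V : ℝ) * h1 + (∑ i, v i) * h2

end Matrix

namespace SimpleGraph

open Finset Matrix

variable {V : Type*} [Fintype V] [DecidableEq V] (G : SimpleGraph V) [DecidableRel G.Adj]

lemma lapMatrix_mulVec_one : G.lapMatrix ℝ *ᵥ 1 = 0 :=
  G.lapMatrix_mulVec_const_eq_zero

/-- The matrix-tree theorem for rank-one perturbations of the Laplacian matrix. -/
theorem det_lapMatrix_add_vecMulVec [Nonempty V] (u v : V → ℝ) :
    (G.lapMatrix ℝ + vecMulVec u v).det = (∑ i, u i) * (∑ i, v i) * G.numSpanningTrees := by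
  obtain ⟨r⟩ := ‹Nonempty V›
  have hn : (Fintype.card V : ℝ) ^ 2 ≠ 0 :=
    pow_ne_zero _ (Nat.cast_ne_zero.2 (Fintype.card_pos_iff.2 ⟨r⟩).ne')
  have hL := G.lapMatrix_mulVec_one
  have hs := G.isSymm_lapMatrix (R := ℝ)
  -- replacing row `r` by `e_r` adds `e_r (e_r - L_r)ᵀ`, whose two factors have entry sum `1`
  have hupd : (G.lapMatrix ℝ).updateRow r (Pi.single r 1) = G.lapMatrix ℝ +
      vecMulVec (Pi.single r 1) (Pi.single r 1 - G.lapMatrix ℝ r) := by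
    ext i j
    by_cases hi : i = r
    · subst hi
      simp [vecMulVec_apply]
    · simp [vecMulVec_apply, hi]
  have hrow : ∑ j, G.lapMatrix ℝ r j = 0 := by
    have := congrFun hL r
    simpa [mulVec, dotProduct] using this
  have h1 := G.det_updateRow_lapMatrix r
  have h2 := card_sq_mul_det_add_vecMulVec hs hL (Pi.single r 1)
    (Pi.single r 1 - G.lapMatrix ℝ r)
  rw [← hupd, h1] at h2
  simp only [Pi.sub_apply, Finset.sum_sub_distrib, hrow, Finset.sum_pi_single', mem_univ, if_true,
    sub_zero, one_mul] at h2
  have h3 := card_sq_mul_det_add_vecMulVec hs hL u v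
  refine mul_left_cancel₀ hn ?_
  rw [h3, ← h2]
  ring

lemma det_smul_one_add_smul_lapMatrix {c : ℝ} (hc : c ≠ 0) (x : ℝ) :
    (x • (1 : Matrix V V ℝ) + c • G.lapMatrix ℝ).det =
      ∏ i, (x + c * G.lapEigenvalue i) := by
  have hH := G.isHermitian_lapMatrix (R := ℝ)
  have h1 : x • (1 : Matrix V V ℝ) + c • G.lapMatrix ℝ =
      (-c) • (Matrix.scalar V (-(x / c)) - G.lapMatrix ℝ) := by
    ext i j
    by_cases hij : i = j
    · subst hij
      simp
      field_simp
      ring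
    · simp [hij]
  have hpow : (-c) ^ Fintype.card V = ∏ _i : V, (-c) := by simp
  rw [h1, det_smul, ← eval_charpoly, hH.charpoly_eq, Polynomial.eval_prod, hpow,
    ← Finset.prod_mul_distrib]
  let e : Fin (Fintype.card V) ≃ V :=
    Fin.revPerm.trans (Fintype.equivOfCardEq (Fintype.card_fin _))
  refine (Fintype.prod_equiv e _ _ fun i => ?_).symm
  simp [e, lapEigenvalue, IsHermitian.eigenvalues]
  field_simp
  ring

lemma lapEigenvalue_zero (h : 0 < Fintype.card V) : G.lapEigenvalue ⟨0, h⟩ = 0 := by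
  have hV : Nonempty V := Fintype.card_pos_iff.1 h
  have hH := G.isHermitian_lapMatrix (R := ℝ)
  have hprod := G.det_smul_one_add_smul_lapMatrix one_ne_zero 0
  simp only [zero_smul, one_smul, zero_add, one_mul, det_lapMatrix_eq_zero] at hprod
  obtain ⟨i, -, hi⟩ := Finset.prod_eq_zero_iff.1 hprod.symm
  have hle : G.lapEigenvalue ⟨0, h⟩ ≤ G.lapEigenvalue i :=
    hH.eigenvalues₀_antitone (Fin.rev_le_rev.2 (Fin.mk_le_of_le_val (Nat.zero_le _)))
  refine le_antisymm (hle.trans hi.le) ?_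
  have hnn := (G.posSemidef_lapMatrix ℝ).eigenvalues_nonneg
    ((Fintype.equivOfCardEq (Fintype.card_fin _)) (Fin.rev ⟨0, h⟩))
  simpa [IsHermitian.eigenvalues, lapEigenvalue] using hnn

lemma _root_.Fin.prod_univ_eq_mul_prod_filter {n : ℕ} (h : 0 < n) (f : Fin n → ℝ) :
    ∏ i, f i = f ⟨0, h⟩ * ∏ i with 1 ≤ i.val, f i := by
  rw [← Finset.mul_prod_erase univ f (mem_univ ⟨0, h⟩)]
  congr 2
  ext i
  simp [Fin.ext_iff, Nat.one_le_iff_ne_zero]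

/-- For `x > 0`, the matrix `x + c L + J` factors as `(x + c L) (1 + x⁻¹ J)`; let `x` tend to `0`.
-/
lemma det_smul_lapMatrix_add_vecMulVec_one [Nonempty V] {c : ℝ} (hc : c ≠ 0) :
    (c • G.lapMatrix ℝ + vecMulVec 1 1).det =
      Fintype.card V * ∏ i with 1 ≤ i.val, (c * G.lapEigenvalue i) := by
  have hcard : 0 < Fintype.card V := Fintype.card_pos
  have key : ∀ x : ℝ, 0 < x → (x • (1 : Matrix V V ℝ) + c • G.lapMatrix ℝ + vecMulVec 1 1).det =
      (x + Fintype.card V) * ∏ i with 1 ≤ i.val, (x + c * G.lapEigenvalue i) := by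
    intro x hx
    have hfac : x • (1 : Matrix V V ℝ) + c • G.lapMatrix ℝ + vecMulVec 1 1 =
        (x • (1 : Matrix V V ℝ) + c • G.lapMatrix ℝ) * (1 + vecMulVec (x⁻¹ • 1) 1) := by
      rw [mul_add, mul_one, mul_vecMulVec, add_mulVec, smul_mulVec, one_mulVec, smul_smul,
        mul_inv_cancel₀ hx.ne', one_smul, mulVec_smul, smul_mulVec, lapMatrix_mulVec_one]
      simp
    rw [hfac, det_mul, det_smul_one_add_smul_lapMatrix G hc, det_one_add_vecMulVec,
      Fin.prod_univ_eq_mul_prod_filter hcard, lapEigenvalue_zero]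
    simp [dotProduct]
    field_simp
  -- both sides are continuous in `x` and agree on the positive reals
  have hcl : Set.EqOn (fun x : ℝ =>
      (x • (1 : Matrix V V ℝ) + c • G.lapMatrix ℝ + vecMulVec 1 1).det)
      (fun x => (x + Fintype.card V) * ∏ i with 1 ≤ i.val, (x + c * G.lapEigenvalue i))
      (closure (Set.Ioi 0)) :=
    Set.EqOn.closure (fun x hx => key x hx) (by fun_prop) (by fun_prop)
  have h0 : (0 : ℝ) ∈ closure (Set.Ioi (0 : ℝ)) := by simp
  simpa using hcl h0

end SimpleGraph

/-! ### The Laplacian matrix of the corona -/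

namespace SimpleGraph

open Finset Matrix Kronecker

section

variable {V : Type*} [Fintype V] [DecidableEq V] (G : SimpleGraph V) [DecidableRel G.Adj]

lemma lapMatrix_eq_of_sum_row_eq_zero {M : Matrix V V ℝ}
    (hoff : ∀ v w, v ≠ w → M v w = if G.Adj v w then -1 else 0) (hsum : ∀ v, ∑ w, M v w = 0) :
    G.lapMatrix ℝ = M := by
  have hne : ∀ v w, v ≠ w → G.lapMatrix ℝ v w = M v w := by
    intro v w h
    rw [hoff v w h]
    simp [lapMatrix, degMatrix, h]
    split_ifs <;> simp
  ext v w
  by_cases h : v = w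
  · subst h
    have h1 : ∑ w, G.lapMatrix ℝ v w = 0 := by
      simpa [mulVec, dotProduct] using congrFun G.lapMatrix_mulVec_one v
    have h2 := hsum v
    rw [← Finset.add_sum_erase _ _ (mem_univ v)] at h1 h2
    rw [Finset.sum_congr rfl fun w hw => hne v w (ne_of_mem_erase hw).symm] at h1
    linarith
  · exact hne v w h

omit [DecidableEq V] in
lemma sum_edgeSet_eq_sum_of_eq_zero {f : Sym2 V → ℝ} (hf : ∀ e, e ∉ G.edgeSet → f e = 0) :
    ∑ e : G.edgeSet, f e = ∑ e, f e := by
  rw [← Finset.sum_subset (subset_univ G.edgeFinset)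
    fun e _ he => hf e (by simpa using he), ← Finset.sum_subtype]
  simp

lemma sum_edgeSet_incMatrix (v : V) : ∑ e : G.edgeSet, G.incMatrix ℝ v e = G.degree v := by
  rw [sum_edgeSet_eq_sum_of_eq_zero G (f := G.incMatrix ℝ v), sum_incMatrix_apply]
  intro e he
  exact G.incMatrix_of_notMem_incidenceSet fun h => he h.1

lemma sum_edgeSet_incMatrix_mul_incMatrix (v w : V) :
    ∑ e : G.edgeSet, G.incMatrix ℝ v e * G.incMatrix ℝ w e =
      if v = w then (G.degree v : ℝ) else if G.Adj v w then 1 else 0 := by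
  rw [sum_edgeSet_eq_sum_of_eq_zero G (f := fun e => G.incMatrix ℝ v e * G.incMatrix ℝ w e)]
  · have := congrFun (congrFun (G.incMatrix_mul_transpose (R := ℝ)) v) w
    simpa [mul_apply] using this
  · intro e he
    rw [G.incMatrix_of_notMem_incidenceSet fun h => he h.1, zero_mul]

end

variable {V₁ V₂ : Type*} [Fintype V₁] [DecidableEq V₁] [Fintype V₂] [DecidableEq V₂]
  (G₁ : SimpleGraph V₁) [DecidableRel G₁.Adj] (G₂ : SimpleGraph V₂) [DecidableRel G₂.Adj]

/-- The block of the Laplacian matrix of `G₁ ⊟ G₂` with rows in `V₁` and columns in the inserted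
vertices and the copies of `G₂`: minus the incidence of a vertex with the edge a column belongs to.
-/
def coronaOffDiagBlock (V₂ : Type*) : Matrix V₁ (G₁.edgeSet ⊕ G₁.edgeSet × V₂) ℝ :=
  Matrix.of fun v x => -G₁.incMatrix ℝ v (Sum.elim id Prod.fst x : G₁.edgeSet)

/-- The block of the Laplacian matrix of `G₁ ⊟ G₂` on the inserted vertices and the copies of `G₂`:
it is `2` on each inserted vertex and `2 + L(G₂)` on each copy. The factor `1 •` matches
`det_smul_one_add_smul_lapMatrix`. -/
def coronaDiagBlock : Matrix (G₁.edgeSet ⊕ G₁.edgeSet × V₂) (G₁.edgeSet ⊕ G₁.edgeSet × V₂) ℝ :=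
  fromBlocks ((2 : ℝ) • 1) 0 0
    ((1 : Matrix G₁.edgeSet G₁.edgeSet ℝ) ⊗ₖ ((2 : ℝ) • 1 + (1 : ℝ) • G₂.lapMatrix ℝ))

lemma det_coronaDiagBlock : (coronaDiagBlock G₁ G₂).det =
    2 ^ G₁.edgeFinset.card * ∏ i, (2 + G₂.lapEigenvalue i) ^ G₁.edgeFinset.card := by
  rw [coronaDiagBlock, det_fromBlocks_zero₂₁, det_kronecker,
    det_smul_one_add_smul_lapMatrix G₂ one_ne_zero, Finset.prod_pow]
  simp [edgeFinset_card]

/-- A function that is constant on each inserted vertex together with its copy of `G₂` is an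
eigenvector for the eigenvalue `2`, because the rows of `L(G₂)` sum to zero. -/
lemma coronaDiagBlock_mulVec (f : G₁.edgeSet → ℝ) :
    coronaDiagBlock G₁ G₂ *ᵥ (f ∘ Sum.elim id Prod.fst) =
      (2 : ℝ) • (f ∘ Sum.elim id Prod.fst) := by
  ext (e | ⟨e, u⟩)
  · simp [coronaDiagBlock, mulVec, dotProduct, one_apply]
  · have hlap : ∑ w, G₂.lapMatrix ℝ u w = 0 := by
      simpa [mulVec, dotProduct] using congrFun G₂.lapMatrix_mulVec_one u
    simp [coronaDiagBlock, mulVec, dotProduct, Fintype.sum_prod_type, one_apply,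
      ← Finset.sum_mul, Finset.sum_add_distrib, hlap]

lemma lapMatrix_corona_eq_submatrix [DecidableRel (G₁.subdivisionEdgeNbhdCorona G₂).Adj] :
    ((G₁.subdivisionEdgeNbhdCorona G₂).lapMatrix ℝ) =
      (fromBlocks (diagonal fun v => (1 + Fintype.card V₂ : ℝ) * G₁.degree v)
        (coronaOffDiagBlock G₁ V₂) (coronaOffDiagBlock G₁ V₂)ᵀ
        (coronaDiagBlock G₁ G₂)).submatrix (Equiv.sumAssoc _ _ _) (Equiv.sumAssoc _ _ _) := by
  have hinc : ∀ (v : V₁) (e : G₁.edgeSet),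
      G₁.incMatrix ℝ v e = if v ∈ (e : Sym2 V₁) then 1 else 0 := by
    intro v e
    rw [incMatrix_apply']
    simp [incidenceSet, e.2]
  apply lapMatrix_eq_of_sum_row_eq_zero
  · rintro ((v | e) | ⟨e, u⟩) ((w | f) | ⟨f, u'⟩) hne
    · have : v ≠ w := by rintro rfl; exact hne rfl
      simp [subdivisionEdgeNbhdCorona, subdivisionGraph, this]
    · by_cases h : v ∈ (f : Sym2 V₁) <;>
        simp [coronaOffDiagBlock, hinc, subdivisionEdgeNbhdCorona, subdivisionGraph, h]
    · by_cases h : v ∈ (f : Sym2 V₁) <;>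
        simp [coronaOffDiagBlock, hinc, subdivisionEdgeNbhdCorona, subdivisionGraph, h]
    · by_cases h : w ∈ (e : Sym2 V₁) <;>
        simp [coronaOffDiagBlock, hinc, subdivisionEdgeNbhdCorona, subdivisionGraph, h]
    · have : e ≠ f := by rintro rfl; exact hne rfl
      simp [subdivisionEdgeNbhdCorona, subdivisionGraph, this, coronaDiagBlock]
    · simp [subdivisionEdgeNbhdCorona, subdivisionGraph, coronaDiagBlock]
    · by_cases h : w ∈ (e : Sym2 V₁) <;>
        simp [coronaOffDiagBlock, hinc, subdivisionEdgeNbhdCorona, subdivisionGraph, h]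
    · simp [subdivisionEdgeNbhdCorona, subdivisionGraph, coronaDiagBlock]
    · by_cases hef : e = f
      · subst hef
        have : u ≠ u' := by rintro rfl; exact hne rfl
        by_cases h : G₂.Adj u u' <;>
          simp [subdivisionEdgeNbhdCorona, coronaDiagBlock, lapMatrix, degMatrix, this, h]
      · simp [subdivisionEdgeNbhdCorona, coronaDiagBlock, hef]
  · intro x
    have hD : ∀ y, ∑ z, coronaDiagBlock G₁ G₂ y z = 2 := fun y => by
      simpa [mulVec, dotProduct] using congrFun (coronaDiagBlock_mulVec G₁ G₂ 1) y
    rw [← Equiv.sum_comp (Equiv.sumAssoc V₁ G₁.edgeSet (G₁.edgeSet × V₂)).symm]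
    simp only [submatrix_apply, Equiv.apply_symm_apply]
    rcases x with (v | e) | ⟨e, u⟩
    · simp [coronaOffDiagBlock, Fintype.sum_prod_type, diagonal_apply, ← Finset.mul_sum,
        sum_edgeSet_incMatrix]
      ring
    · rw [Fintype.sum_sum_type]
      simp only [Equiv.sumAssoc_apply_inl_inr, fromBlocks_apply₂₁, fromBlocks_apply₂₂, hD]
      simp [coronaOffDiagBlock, G₁.sum_incMatrix_apply_of_mem_edgeSet e.2]
    · rw [Fintype.sum_sum_type]
      simp only [Equiv.sumAssoc_apply_inr, fromBlocks_apply₂₁, fromBlocks_apply₂₂, hD]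
      simp [coronaOffDiagBlock, G₁.sum_incMatrix_apply_of_mem_edgeSet e.2]

/-- Column elimination: the diagonal block of the inserted vertices and the copies of `G₂` sends
the incidence vector of a vertex to twice itself, because the rows of `L(G₂)` sum to zero. What is
left on `V₁` is a multiple of `L(G₁)`. -/
lemma det_corona_fromBlocks (J : Matrix V₁ V₁ ℝ) :
    (fromBlocks ((diagonal fun v => (1 + Fintype.card V₂ : ℝ) * G₁.degree v) + J)
        (coronaOffDiagBlock G₁ V₂) (coronaOffDiagBlock G₁ V₂)ᵀ (coronaDiagBlock G₁ G₂)).det =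
      (((1 + Fintype.card V₂ : ℝ) / 2) • G₁.lapMatrix ℝ + J).det *
        (coronaDiagBlock G₁ G₂).det := by
  set B := coronaOffDiagBlock G₁ V₂ with hB
  set X : Matrix (G₁.edgeSet ⊕ G₁.edgeSet × V₂) V₁ ℝ := (-(1 / 2 : ℝ)) • Bᵀ with hX
  have hDX : Bᵀ + coronaDiagBlock G₁ G₂ * X = 0 := by
    ext x v
    have h := congrFun (coronaDiagBlock_mulVec G₁ G₂ fun e => G₁.incMatrix ℝ v e) x
    have hmul : (coronaDiagBlock G₁ G₂ * X) x v = (1 / 2) * (coronaDiagBlock G₁ G₂ *ᵥ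
        ((fun e : G₁.edgeSet => G₁.incMatrix ℝ v e) ∘ Sum.elim id Prod.fst)) x := by
      simp only [mul_apply, mulVec, dotProduct, Finset.mul_sum]
      refine Finset.sum_congr rfl fun y _ => ?_
      simp [hX, hB, coronaOffDiagBlock]
      ring
    rw [Matrix.add_apply, hmul, h]
    simp [hB, coronaOffDiagBlock]
  have hAX : (diagonal fun v => (1 + Fintype.card V₂ : ℝ) * G₁.degree v) + B * X =
      ((1 + Fintype.card V₂ : ℝ) / 2) • G₁.lapMatrix ℝ := by
    ext v w
    have h := sum_edgeSet_incMatrix_mul_incMatrix G₁ v w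
    have hBX : (B * X) v w = -((1 + Fintype.card V₂ : ℝ) / 2) *
        ∑ e : G₁.edgeSet, G₁.incMatrix ℝ v e * G₁.incMatrix ℝ w e := by
      simp [hX, hB, coronaOffDiagBlock, mul_apply, Fintype.sum_prod_type, Finset.mul_sum,
        ← Finset.sum_add_distrib]
      refine Finset.sum_congr rfl fun e _ => ?_
      ring
    rw [Matrix.add_apply, hBX, h]
    by_cases hvw : v = w
    · subst hvw
      simp [lapMatrix, degMatrix]
      ring
    · by_cases hadj : G₁.Adj v w <;> simp [lapMatrix, degMatrix, hvw, hadj]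
  have hone : (fromBlocks (1 : Matrix V₁ V₁ ℝ) 0 X 1).det = 1 := by
    rw [det_fromBlocks_zero₁₂, det_one, det_one, one_mul]
  have helim := det_mul (fromBlocks
    ((diagonal fun v => (1 + Fintype.card V₂ : ℝ) * G₁.degree v) + J) B Bᵀ
    (coronaDiagBlock G₁ G₂)) (fromBlocks 1 0 X 1)
  rw [hone, mul_one, fromBlocks_multiply] at helim
  simp only [Matrix.mul_one, Matrix.mul_zero, zero_add, hDX] at helim
  rw [← helim, det_fromBlocks_zero₂₁, ← hAX, add_right_comm]

/-- The number of spanning trees of `G₁ ⊟ G₂` in terms of the Laplacian eigenvalues, for an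
arbitrary graph `G₁`. -/
theorem card_mul_numSpanningTrees_corona [Nonempty V₁] :
    (Fintype.card V₁ : ℝ) * (G₁.subdivisionEdgeNbhdCorona G₂).numSpanningTrees =
      2 ^ G₁.edgeFinset.card * (∏ i, (2 + G₂.lapEigenvalue i) ^ G₁.edgeFinset.card) *
        ∏ i with 1 ≤ i.val, ((1 + Fintype.card V₂ : ℝ) / 2 * G₁.lapEigenvalue i) := by
  classical
  set e := Equiv.sumAssoc V₁ G₁.edgeSet (G₁.edgeSet × V₂)
  set u : (V₁ ⊕ G₁.edgeSet) ⊕ G₁.edgeSet × V₂ → ℝ := Sum.elim (Sum.elim 1 0) 0 with hu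
  have hmt := (G₁.subdivisionEdgeNbhdCorona G₂).det_lapMatrix_add_vecMulVec u u
  have hJ : vecMulVec u u = (fromBlocks (vecMulVec 1 1) 0 0 0).submatrix e e := by
    ext ((v | x) | x) ((w | y) | y) <;> simp [hu, e, vecMulVec_apply]
  have hsum : ∑ x, u x = Fintype.card V₁ := by simp [hu]
  have hadd : ∀ A B : Matrix (V₁ ⊕ G₁.edgeSet ⊕ G₁.edgeSet × V₂) _ ℝ,
      (A + B).submatrix e e = A.submatrix e e + B.submatrix e e := fun _ _ => rfl
  have hc : (1 + Fintype.card V₂ : ℝ) / 2 ≠ 0 := by positivity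
  rw [lapMatrix_corona_eq_submatrix, hJ, ← hadd, fromBlocks_add,
    det_submatrix_equiv_self, add_zero, add_zero, add_zero, det_corona_fromBlocks,
    det_smul_lapMatrix_add_vecMulVec_one G₁ hc, det_coronaDiagBlock, hsum] at hmt
  have hn : (Fintype.card V₁ : ℝ) ≠ 0 := Nat.cast_ne_zero.2 Fintype.card_ne_zero
  refine mul_left_cancel₀ hn ?_
  linear_combination -hmt

end SimpleGraph

theorem corollary3p7 {V₁ V₂ : Type*} [Fintype V₁] [DecidableEq V₁] [Nonempty V₁]
    [Fintype V₂] [DecidableEq V₂]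
    (G₁ : SimpleGraph V₁) [DecidableRel G₁.Adj] (G₂ : SimpleGraph V₂) [DecidableRel G₂.Adj]
    (n₁ m₁ n₂ r₁ : ℕ) (hn₁ : Fintype.card V₁ = n₁) (hm₁ : G₁.edgeFinset.card = m₁)
    (hn₂ : Fintype.card V₂ = n₂) (hr₁ : G₁.IsRegularOfDegree r₁) :
    ((G₁.subdivisionEdgeNbhdCorona G₂).numSpanningTrees : ℝ) =
      ((2 : ℝ) ^ ((m₁ : ℤ) - (n₁ : ℤ)) * (2 + (r₁ : ℝ) + (r₁ : ℝ) * (n₂ : ℝ)) *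
          (∏ i : Fin (Fintype.card V₂), (2 + G₂.lapEigenvalue i) ^ m₁) *
          (∏ i : Fin (Fintype.card V₁) with 1 ≤ i.val,
            ((1 + (n₂ : ℝ)) * G₁.lapEigenvalue i))) /
        ((n₁ : ℝ) + (m₁ : ℝ) + (m₁ : ℝ) * (n₂ : ℝ)) := by
  have hpos : 0 < Fintype.card V₁ := Fintype.card_pos
  have hmain := G₁.card_mul_numSpanningTrees_corona G₂
  have hdeg : (n₁ : ℝ) * r₁ = 2 * m₁ := by
    have := G₁.sum_degrees_eq_twice_card_edges
    simp only [hr₁.degree_eq, Finset.sum_const, Finset.card_univ, smul_eq_mul, hn₁, hm₁] at this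
    exact_mod_cast this
  have htwo : ∏ i : Fin (Fintype.card V₁) with 1 ≤ i.val,
      ((1 + (n₂ : ℝ)) / 2 * G₁.lapEigenvalue i) * 2 =
        ∏ i : Fin (Fintype.card V₁) with 1 ≤ i.val, ((1 + (n₂ : ℝ)) * G₁.lapEigenvalue i) :=
    Finset.prod_congr rfl fun i _ => by ring
  have hcount : ∏ i : Fin (Fintype.card V₁) with 1 ≤ i.val, (2 : ℝ) = 2 ^ n₁ / 2 := by
    have := Fin.prod_univ_eq_mul_prod_filter hpos fun _ => (2 : ℝ)
    rw [Finset.prod_const, Finset.card_univ, Fintype.card_fin] at this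
    rw [← hn₁]
    linarith
  rw [Finset.prod_mul_distrib, hcount] at htwo
  have hn₁' : (Fintype.card V₁ : ℝ) = n₁ := by rw [hn₁]
  have hn₂' : (Fintype.card V₂ : ℝ) = n₂ := by rw [hn₂]
  rw [hm₁, hn₁', hn₂'] at hmain
  rw [← htwo, zpow_sub₀ two_ne_zero, zpow_natCast, zpow_natCast]
  have hn : (0 : ℝ) < n₁ := by exact_mod_cast hn₁ ▸ hpos
  have hden : (0 : ℝ) < n₁ + m₁ + m₁ * n₂ := by positivity
  rw [eq_div_iff hden.ne']
  refine mul_left_cancel₀ hn.ne' ?_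
  have hpow : (2 : ℝ) ^ m₁ / 2 ^ n₁ * (2 ^ n₁ / 2) = 2 ^ m₁ / 2 := by field_simp
  set P := ∏ i : Fin (Fintype.card V₂), (2 + G₂.lapEigenvalue i) ^ m₁
  set Q := ∏ i : Fin (Fintype.card V₁) with 1 ≤ i.val, ((1 + (n₂ : ℝ)) / 2 * G₁.lapEigenvalue i)
  linear_combination ((n₁ : ℝ) + m₁ + m₁ * n₂) * hmain -
    n₁ * (2 + r₁ + r₁ * n₂) * P * Q * hpow - 2 ^ m₁ * P * Q * ((1 + n₂) / 2) * hdeg
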